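/- Let $a<b$ be real numbers, $0<\alpha<1$, and let $m,\bar n\in\mathbb N=\{1,2,\dots\}$. **Operators.** Put $\varphi(t)=\dfrac{t}{\sqrt[2m]{1+t^{2m}}}$ and $\Phi(t)=\frac14\left[\varphi(t+1)-\varphi(t-1)\right]$ for $t\in\mathbb R$. For $n\in\mathbb N$ with $\lceil na\rceil\le\lfloor nb\rfloor$ and $f\in C([a,b])$ let $$(A_nf)(x)=\frac{\sum_{k=\lceil na\rceil}^{\lfloor nb\rfloor}f\left(\frac kn\right)\Phi(nx-k)}{\sum_{k=\lceil na\rceil}^{\lfloor nb\rfloor}\Phi(nx-k)},\qquad x\in[a,b].$$ **Fractional derivatives.** For $x\in[a,b]$ and $g$ absolutely continuous on $[x,b]$ (respectively on $[a,x]$) the left (respectively right) Caputo derivative of order $\alpha$ is $$(D_{*x}^{\alpha}g)(y)=\frac{1}{\Gamma(1-\alpha)}\int_x^y (y-t)^{-\alpha}g'(t)\,dt\ \ (y\in[x,b]),\qquad (D_{x-}^{\alpha}g)(y)=\frac{-1}{\Gamma(1-\alpha)}\int_y^x (z-y)^{-\alpha}g'(z)\,dz\ \ (y\in[a,x]).$$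 $D_{*x}^{k\alpha}$ and $D_{x-}^{k\alpha}$ denote the $k$-fold iterates of $D_{*x}^{\alpha}$ and $D_{x-}^{\alpha}$ ($k\ge0$). For $\delta>0$ let $\omega_1(g,\delta)_{I}=\sup\{|g(u)-g(v)|:u,v\in I,\ |u-v|\le\delta\}$ and $$\omega_1\left(D_x^{(\bar n+1)\alpha}f,\delta\right)=\max\left\{\omega_1\left(D_{*x}^{(\bar n+1)\alpha}f,\delta\right)_{[x,b]},\ \omega_1\left(D_{x-}^{(\bar n+1)\alpha}f,\delta\right)_{[a,x]}\right\}.$$ **Statement.** Let $f:[a,b]\to\mathbb R$ be absolutely continuous with $f'\in L_\infty([a,b])$, and fix $x\in[a,b]$. Assume that $D_{*x}^{k\alpha}f$ is absolutely continuous on $[x,b]$ and $D_{x-}^{k\alpha}f$ is absolutely continuous on $[a,x]$ for $k=0,\dots,\bar n$ (so that the iterated derivatives are defined), that $D_{*x}^{k\alpha}f\in C([x,b])$ and $D_{x-}^{k\alpha}f\in C([a,x])$ for $k=0,1,\dots,\bar n+1$, and that $(D_{*x}^{i\alpha}f)(x)=0=(D_{x-}^{i\alpha}f)(x)$ for $i=2,3,\dots,\bar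 n+1$. Then for every $n\in\mathbb N$ with $n^{1-\alpha}>2$ and $\lceil na\rceil\le\lfloor nb\rfloor$, $$\left|(A_nf)(x)-f(x)\right|\le\frac{2\left(\sqrt[2m]{1+4^m}\right)\,\omega_1\left(D_x^{(\bar n+1)\alpha}f,\frac{1}{(\bar n+1)\alpha+1}\right)}{\Gamma\left((\bar n+1)\alpha+1\right)}\left\{\left[\frac{1}{n^{(\bar n+1)\alpha^2}}+\frac{(b-a)^{(\bar n+1)\alpha}}{4m\left(n^{1-\alpha}-2\right)^{2m}}\right]+\left[\frac{1}{n^{\alpha[(\bar n+1)\alpha+1]}}+\frac{(b-a)^{(\bar n+1)\alpha+1}}{4m\left(n^{1-\alpha}-2\right)^{2m}}\right]\right\}.$$ Consequently $\lim_{n\to+\infty}(A_nf)(x)=f(x)$. -/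

import Mathlib

open Filter Topology MeasureTheory

noncomputable section

/-- The algebraic sigmoid `φ(x) = x / (1 + x^{2m})^{1/(2m)}`. -/
def algSigmoid (m : ℕ) (x : ℝ) : ℝ :=
  x / (1 + x ^ (2 * m)) ^ (1 / (2 * (m : ℝ)))

/-- The density (activation) function `Φ(x) = (φ(x+1) - φ(x-1)) / 4`. -/
def algDensity (m : ℕ) (x : ℝ) : ℝ :=
  (1 / 4) * (algSigmoid m (x + 1) - algSigmoid m (x - 1))

/-- The neural network operator
`A_n(f, x) = (∑ f(k/n) Φ(nx - k)) / (∑ Φ(nx - k))`, both sums over `⌈na⌉ ≤ k ≤ ⌊nb⌋`. -/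
def nnOperator (m : ℕ) (a b : ℝ) (n : ℕ) (f : ℝ → ℝ) (x : ℝ) : ℝ :=
  (∑ k ∈ Finset.Icc ⌈(n : ℝ) * a⌉ ⌊(n : ℝ) * b⌋,
      f ((k : ℝ) / (n : ℝ)) * algDensity m ((n : ℝ) * x - (k : ℝ))) /
    (∑ k ∈ Finset.Icc ⌈(n : ℝ) * a⌉ ⌊(n : ℝ) * b⌋,
      algDensity m ((n : ℝ) * x - (k : ℝ)))

/-- The first modulus of continuity of `g` on the set `s`:
`ω₁(g, δ)_s = sup { |g u - g v| : u, v ∈ s, |u - v| ≤ δ }`. -/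
def modulusOn (g : ℝ → ℝ) (s : Set ℝ) (δ : ℝ) : ℝ :=
  sSup {r : ℝ | ∃ u ∈ s, ∃ v ∈ s, |u - v| ≤ δ ∧ r = |g u - g v|}

/-- The left Caputo fractional derivative of order `0 < α < 1` with base point `x`:
`(D_{*x}^α g)(y) = (1 / Γ(1-α)) ∫_x^y (y-t)^{-α} g'(t) dt` for `y ≥ x`, and `0` for `y < x`
(the domain of integration is then empty). It is meant for `g` absolutely continuous. -/
def leftCaputo (α x : ℝ) (g : ℝ → ℝ) (y : ℝ) : ℝ :=
  (1 / Real.Gamma (1 - α)) * ∫ t in Set.Ioc x y, (y - t) ^ (-α) * deriv g t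

/-- The right Caputo fractional derivative of order `0 < α < 1` with base point `x`:
`(D_{x-}^α g)(y) = (-1 / Γ(1-α)) ∫_y^x (z-y)^{-α} g'(z) dz` for `y ≤ x`, and `0` for `y > x`
(the domain of integration is then empty). It is meant for `g` absolutely continuous. -/
def rightCaputo (α x : ℝ) (g : ℝ → ℝ) (y : ℝ) : ℝ :=
  (-1 / Real.Gamma (1 - α)) * ∫ z in Set.Ioc y x, (z - y) ^ (-α) * deriv g z

/-- The iterated left derivative `D_{*x}^{kα} f = D_{*x}^α ⋯ D_{*x}^α f` (`k` times). -/
def iterLeftCaputo (α x : ℝ) (k : ℕ) (f : ℝ → ℝ) : ℝ → ℝ :=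
  (leftCaputo α x)^[k] f

/-- The iterated right derivative `D_{x-}^{kα} f = D_{x-}^α ⋯ D_{x-}^α f` (`k` times). -/
def iterRightCaputo (α x : ℝ) (k : ℕ) (f : ℝ → ℝ) : ℝ → ℝ :=
  (rightCaputo α x)^[k] f

/-- `ω₁(D_x^{kα} f, δ)`: the larger of the modulus of continuity of the left iterated derivative
over `[x, b]` and that of the right iterated derivative over `[a, x]`. -/
def iterModulus (α a b x : ℝ) (k : ℕ) (f : ℝ → ℝ) (δ : ℝ) : ℝ :=
  max (modulusOn (iterLeftCaputo α x k f) (Set.Icc x b) δ)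
    (modulusOn (iterRightCaputo α x k f) (Set.Icc a x) δ)

end

/-! ### Riemann–Liouville integrals -/

/-! Write β = (N+1)α and let I^c be the Riemann–Liouville integral of order c based at x. For
absolutely continuous g, I^α inverts the Caputo derivative up to a constant: I^α I^(1-α) g' = I^1 g'
= g - g(x). Iterated derivatives of order k ≥ 1 vanish at x, so iterating with I^(kα) I^α =
I^((k+1)α) leaves no intermediate Taylor terms: f(y) - f(x) = I^β (D^((N+1)α) f)(y). Bounding the
integrand through its modulus of continuity gives |f(y) - f(x)| ≤ W/Γ(β+1) · (|y-x|^β +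
|y-x|^(β+1)); the right-hand case follows by reflection.

The error of the operator is a weighted mean of the values f(k/n) - f(x). Nodes with |k/n - x| <
n^(-α) are handled by the pointwise bound. The other nodes carry little weight: sums of the density
telescope, and 1 - φ(s) decays like s^(-2m). The denominator is bounded below because some node lies
within distance 1 of nx (`algDensity_lower`, `exists_int_near`). The stated constant allows the tail
estimate of one side only, although both sides may contribute; `sum_algDensity_filter_le` recovers
this factor 2. -/

open Set in
lemma integral_Ioo_rpow_mul_rpow {a b t y : ℝ} (ha : 0 < a) (hb : 0 < b) (hty : t < y) :
    ∫ s in Ioo t y, (y - s) ^ (a - 1) * (s - t) ^ (b - 1) =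
      ProbabilityTheory.beta a b * (y - t) ^ (a + b - 1) := by
  -- The real identity is obtained by casting the scaled complex Beta integral down to ℝ and
  -- translating by t.
  have h := Complex.betaIntegral_scaled (b : ℂ) (a : ℂ) (sub_pos.2 hty)
  rw [Complex.betaIntegral_symm] at h
  have hB : (Complex.betaIntegral a b) = ((ProbabilityTheory.beta a b : ℝ) : ℂ) := by
    rw [Complex.betaIntegral_eq_Gamma_mul_div _ _ (by simpa) (by simpa), ProbabilityTheory.beta]
    push_cast [Complex.Gamma_ofReal]
    rw [← Complex.ofReal_add, Complex.Gamma_ofReal]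
  have h2 : ∫ u in (0 : ℝ)..(y - t), u ^ (b - 1) * (y - t - u) ^ (a - 1) =
      (y - t) ^ (a + b - 1) * ProbabilityTheory.beta a b := by
    apply Complex.ofReal_injective
    rw [← intervalIntegral.integral_ofReal, Complex.ofReal_mul,
      Complex.ofReal_cpow (sub_pos.2 hty).le, ← hB]
    push_cast at h ⊢
    rw [add_comm (a : ℂ) b, ← h]
    refine intervalIntegral.integral_congr fun u hu => ?_
    rw [uIcc_of_le (sub_pos.2 hty).le] at hu
    rw [Complex.ofReal_cpow hu.1, Complex.ofReal_cpow (sub_nonneg.2 hu.2)]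
    push_cast
    rfl
  rw [mul_comm, ← h2, ← integral_Ioc_eq_integral_Ioo, ← intervalIntegral.integral_of_le hty.le]
  have h3 := intervalIntegral.integral_comp_sub_right (a := t) (b := y)
    (fun u => u ^ (b - 1) * (y - t - u) ^ (a - 1)) t
  rw [sub_self] at h3
  rw [← h3]
  refine intervalIntegral.integral_congr fun u _ => ?_
  simp only [sub_sub_sub_cancel_right, mul_comm]

open Set in
lemma integrableOn_Ioo_rpow_mul_rpow {a b : ℝ} (ha : 0 < a) (hb : 0 < b) (t y : ℝ) :
    IntegrableOn (fun s => (y - s) ^ (a - 1) * (s - t) ^ (b - 1)) (Ioo t y) := by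
  rcases lt_or_ge t y with hty | hty
  -- The integral of a non-integrable function is 0 by convention, while the value computed above is
  -- positive.
  · by_contra hni
    have h := integral_Ioo_rpow_mul_rpow ha hb hty
    rw [integral_undef hni] at h
    exact (mul_pos (ProbabilityTheory.beta_pos ha hb)
      (Real.rpow_pos_of_pos (sub_pos.2 hty) _)).ne h
  · simp [Ioo_eq_empty_of_le hty]

-- The semigroup law I^a I^b = I^(a+b) without its Gamma factors: exchange the integrals over the
-- triangle t < s, and the inner one is a Beta integral. Weighted integrability of h at the single
-- endpoint y is all that Fubini needs.
open Set in
lemma integral_rpow_mul_integral_rpow_mul {a b x y : ℝ} {h : ℝ → ℝ} (ha : 0 < a) (hb : 0 < b)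
    (hm : AEStronglyMeasurable h (volume.restrict (Ioo x y)))
    (hint : IntegrableOn (fun t => (y - t) ^ (a + b - 1) * h t) (Ioo x y)) :
    ∫ s in Ioo x y, (y - s) ^ (a - 1) * ∫ t in Ioo x s, (s - t) ^ (b - 1) * h t =
      ProbabilityTheory.beta a b * ∫ t in Ioo x y, (y - t) ^ (a + b - 1) * h t := by
  -- Extending the kernel by zero outside the triangle turns both iterated integrals into integrals
  -- over one square.
  set K : ℝ → ℝ → ℝ := fun s t =>
    (Ioi t).indicator (fun s => (y - s) ^ (a - 1) * (s - t) ^ (b - 1)) s with hK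
  have hK0 : ∀ s t, s < y → 0 ≤ K s t := fun s t hs => by
    simp only [hK, indicator_apply, mem_Ioi]
    split_ifs with hst
    · exact mul_nonneg (Real.rpow_nonneg (sub_pos.2 hs).le _)
        (Real.rpow_nonneg (sub_pos.2 hst).le _)
    · exact le_rfl
  have hKint : ∀ t ∈ Ioo x y, ∫ s in Ioo x y, K s t =
      ProbabilityTheory.beta a b * (y - t) ^ (a + b - 1) := fun t ht => by
    rw [hK, setIntegral_indicator measurableSet_Ioi, Ioo_inter_Ioi, max_eq_right ht.1.le,
      integral_Ioo_rpow_mul_rpow ha hb ht.2]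
  have hKi : ∀ t ∈ Ioo x y, IntegrableOn (fun s => K s t) (Ioo x y) := fun t ht => by
    rw [hK, integrableOn_indicator_iff measurableSet_Ioi, inter_comm, Ioo_inter_Ioi,
      max_eq_right ht.1.le]
    exact integrableOn_Ioo_rpow_mul_rpow ha hb t y
  have hKm : Measurable (fun p : ℝ × ℝ => K p.1 p.2) := by
    have : (fun p : ℝ × ℝ => K p.1 p.2) = {p : ℝ × ℝ | p.2 < p.1}.indicator
        (fun p => (y - p.1) ^ (a - 1) * (p.1 - p.2) ^ (b - 1)) := by
      ext p; simp [hK, indicator_apply]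
    rw [this]
    refine Measurable.indicator ?_ (measurableSet_lt measurable_snd measurable_fst)
    fun_prop
  have hF : Integrable (fun p : ℝ × ℝ => K p.1 p.2 * h p.2)
      ((volume.restrict (Ioo x y)).prod (volume.restrict (Ioo x y))) := by
    have hFm : AEStronglyMeasurable (fun p : ℝ × ℝ => K p.1 p.2 * h p.2)
        ((volume.restrict (Ioo x y)).prod (volume.restrict (Ioo x y))) :=
      hKm.aestronglyMeasurable.mul hm.comp_snd
    -- Integrating the norm in s first gives the Beta constant times the integrand of `hint`.
    refine (integrable_prod_iff' hFm).2 ⟨(ae_restrict_iff' measurableSet_Ioo).2 (Eventually.of_forall fun t ht =>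
      (hKi t ht).mul_const (h t)), ?_⟩
    refine (hint.norm.const_mul (ProbabilityTheory.beta a b)).congr ?_
    refine (ae_restrict_iff' measurableSet_Ioo).2 (Eventually.of_forall fun t ht => ?_)
    simp only [norm_mul]
    rw [integral_mul_const, ← mul_assoc,
      Real.norm_of_nonneg (Real.rpow_nonneg (sub_pos.2 ht.2).le _), ← hKint t ht]
    congr 1
    refine setIntegral_congr_fun measurableSet_Ioo fun s hs => ?_
    exact (Real.norm_of_nonneg (hK0 s t hs.2)).symm
  have hswap := integral_integral_swap (f := fun s t => K s t * h t) hF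
  calc _ = ∫ s in Ioo x y, ∫ t in Ioo x y, K s t * h t := by
        refine setIntegral_congr_fun measurableSet_Ioo fun s hs => ?_
        rw [← integral_const_mul]
        have : (fun t => K s t * h t) =
            (Iio s).indicator (fun t => (y - s) ^ (a - 1) * ((s - t) ^ (b - 1) * h t)) := by
          ext t; simp [hK, indicator_apply, mul_assoc]
        rw [this, setIntegral_indicator measurableSet_Iio, Ioo_inter_Iio, min_eq_right hs.2.le]
    _ = ∫ t in Ioo x y, ∫ s in Ioo x y, K s t * h t := hswap
    _ = _ := by
        rw [← integral_const_mul]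
        refine setIntegral_congr_fun measurableSet_Ioo fun t ht => ?_
        rw [integral_mul_const, hKint t ht, mul_assoc]

open Set in
lemma integrableOn_Ioo_rpow_sub {c : ℝ} (hc : 0 < c) (x y : ℝ) :
    IntegrableOn (fun t => (y - t) ^ (c - 1)) (Ioo x y) := by
  simpa using integrableOn_Ioo_rpow_mul_rpow hc one_pos x y

open Set in
lemma integral_Ioo_rpow_sub {c x y : ℝ} (hc : 0 < c) (hxy : x ≤ y) :
    ∫ t in Ioo x y, (y - t) ^ (c - 1) = (y - x) ^ c / c := by
  rcases hxy.eq_or_lt with rfl | hxy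
  · simp [hc.ne']
  · have h := integral_Ioo_rpow_mul_rpow hc one_pos hxy
    simp only [sub_self, Real.rpow_zero, mul_one, add_sub_cancel_right] at h
    rw [h, ProbabilityTheory.beta, Real.Gamma_add_one hc.ne', Real.Gamma_one]
    have := (Real.Gamma_pos_of_pos hc).ne'
    field_simp

/-! ### Fractional Taylor formula -/

open Set in
lemma leftCaputo_eq (α x : ℝ) (g : ℝ → ℝ) (y : ℝ) :
    leftCaputo α x g y =
      (1 / Real.Gamma (1 - α)) * ∫ t in Ioo x y, (y - t) ^ (-α) * deriv g t := by
  rw [leftCaputo, integral_Ioc_eq_integral_Ioo]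

-- The semigroup law with orders α and 1-α: the exponents add up to 0, the kernel disappears, and
-- the fundamental theorem of calculus finishes.
open Set in
lemma sub_eq_integral_leftCaputo {α x y : ℝ} {g : ℝ → ℝ} (hα0 : 0 < α) (hα1 : α < 1)
    (hxy : x ≤ y) (hi : IntervalIntegrable (deriv g) volume x y)
    (hftc : ∫ t in x..y, deriv g t = g y - g x) :
    g y - g x = (1 / Real.Gamma α) * ∫ t in Ioo x y, (y - t) ^ (α - 1) * leftCaputo α x g t := by
  have hio : IntegrableOn (deriv g) (Ioo x y) :=
    (integrableOn_Ioc_iff_integrableOn_Ioo).1 ((intervalIntegrable_iff_integrableOn_Ioc_of_le hxy).1 hi)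
  have h := integral_rpow_mul_integral_rpow_mul (h := deriv g) (x := x) (y := y) hα0
    (sub_pos.2 hα1) hio.aestronglyMeasurable (by simpa using hio)
  simp only [add_sub_cancel, sub_self, Real.rpow_zero, one_mul] at h
  rw [← integral_Ioc_eq_integral_Ioo (f := deriv g), ← intervalIntegral.integral_of_le hxy,
    hftc, ProbabilityTheory.beta] at h
  simp only [add_sub_cancel, Real.Gamma_one, div_one] at h
  have e : ∀ t, (y - t) ^ (α - 1) * leftCaputo α x g t = (1 / Real.Gamma (1 - α)) *
      ((y - t) ^ (α - 1) * ∫ s in Ioo x t, (t - s) ^ (1 - α - 1) * deriv g s) := fun t => by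
    rw [leftCaputo_eq, show 1 - α - 1 = -α by ring]; ring
  simp_rw [e]
  rw [integral_const_mul, h]
  have := (Real.Gamma_pos_of_pos hα0).ne'
  have := (Real.Gamma_pos_of_pos (sub_pos.2 hα1)).ne'
  field_simp

lemma iterLeftCaputo_succ (α x : ℝ) (k : ℕ) (f : ℝ → ℝ) :
    iterLeftCaputo α x (k + 1) f = leftCaputo α x (iterLeftCaputo α x k f) :=
  Function.iterate_succ_apply' _ _ _

lemma iterLeftCaputo_succ_self (α x : ℝ) (k : ℕ) (f : ℝ → ℝ) :
    iterLeftCaputo α x (k + 1) f x = 0 := by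
  simp [iterLeftCaputo_succ, leftCaputo]

open Set in
/-- Fractional Taylor formula for iterated left Caputo derivatives. -/
lemma sub_eq_integral_iterLeftCaputo {α x b : ℝ} {f : ℝ → ℝ} {N : ℕ} (hα0 : 0 < α) (hα1 : α < 1)
    (hi : ∀ k ≤ N, ∀ y ∈ Icc x b,
      IntervalIntegrable (deriv (iterLeftCaputo α x k f)) volume x y)
    (hftc : ∀ k ≤ N, ∀ y ∈ Icc x b, ∫ t in x..y, deriv (iterLeftCaputo α x k f) t =
      iterLeftCaputo α x k f y - iterLeftCaputo α x k f x)
    (hc : ∀ k ≤ N + 1, ContinuousOn (iterLeftCaputo α x k f) (Icc x b)) :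
    ∀ k ≤ N, ∀ y ∈ Icc x b, f y - f x = (1 / Real.Gamma (((k : ℝ) + 1) * α)) *
      ∫ t in Ioo x y, (y - t) ^ (((k : ℝ) + 1) * α - 1) * iterLeftCaputo α x (k + 1) f t := by
  have step : ∀ k ≤ N, ∀ y ∈ Icc x b,
      iterLeftCaputo α x k f y - iterLeftCaputo α x k f x = (1 / Real.Gamma α) *
        ∫ t in Ioo x y, (y - t) ^ (α - 1) * iterLeftCaputo α x (k + 1) f t := fun k hk y hy => by
    rw [iterLeftCaputo_succ]
    exact sub_eq_integral_leftCaputo hα0 hα1 hy.1 (hi k hk y hy) (hftc k hk y hy)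
  intro k
  induction k with
  | zero =>
    intro hk y hy
    simpa [iterLeftCaputo] using step 0 hk y hy
  | succ k ih =>
    intro hk y hy
    have hβ : 0 < ((k : ℝ) + 1) * α := by positivity
    have hβ' : 0 < ((k : ℝ) + 1) * α + α := by positivity
    have hcy : ContinuousOn (iterLeftCaputo α x (k + 1 + 1) f) (Icc x y) :=
      (hc _ (by omega)).mono (Icc_subset_Icc_right hy.2)
    have hJ := integral_rpow_mul_integral_rpow_mul (h := iterLeftCaputo α x (k + 1 + 1) f)
      (x := x) (y := y) hβ hα0
      ((hcy.mono Ioo_subset_Icc_self).aestronglyMeasurable measurableSet_Ioo) (by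
        obtain ⟨C, hC⟩ := isCompact_Icc.exists_bound_of_continuousOn hcy
        refine (integrableOn_Ioo_rpow_sub hβ' x y).mul_bdd (c := C)
          ((hcy.mono Ioo_subset_Icc_self).aestronglyMeasurable measurableSet_Ioo) ?_
        exact (ae_restrict_iff' measurableSet_Ioo).2
          (Eventually.of_forall fun t ht => hC t (Ioo_subset_Icc_self ht)))
    rw [ih (by omega) y hy]
    have e : ∫ t in Ioo x y, (y - t) ^ (((k : ℝ) + 1) * α - 1) * iterLeftCaputo α x (k + 1) f t =
        ∫ t in Ioo x y, (1 / Real.Gamma α) * ((y - t) ^ (((k : ℝ) + 1) * α - 1) *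
          ∫ s in Ioo x t, (t - s) ^ (α - 1) * iterLeftCaputo α x (k + 1 + 1) f s) := by
      refine setIntegral_congr_fun measurableSet_Ioo fun t ht => ?_
      have := step (k + 1) hk t ⟨ht.1.le, ht.2.le.trans hy.2⟩
      -- The base-point value is an integral over an empty interval, so no Taylor term of order
      -- (k+1)α appears.
      rw [iterLeftCaputo_succ_self, sub_zero] at this
      rw [this]; ring
    rw [e, integral_const_mul, hJ, ProbabilityTheory.beta]
    push_cast
    rw [show ((k : ℝ) + 1 + 1) * α = ((k : ℝ) + 1) * α + α by ring]
    have := (Real.Gamma_pos_of_pos hα0).ne'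
    have := (Real.Gamma_pos_of_pos hβ).ne'
    have := (Real.Gamma_pos_of_pos hβ').ne'
    field_simp

-- The weight 1 + (β+1)(t-x) makes the two powers come out with the same constant: I^β sends t-x to
-- (y-x)^(β+1)/Γ(β+2), and β+1 cancels against Γ(β+2) = (β+1)Γ(β+1).
open Set in
lemma abs_integral_rpow_mul_le {β x y W : ℝ} {G : ℝ → ℝ} (hβ : 0 < β) (hxy : x ≤ y)
    (hG : ∀ t ∈ Icc x y, |G t| ≤ (1 + (β + 1) * (t - x)) * W) :
    |(1 / Real.Gamma β) * ∫ t in Ioo x y, (y - t) ^ (β - 1) * G t| ≤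
      W / Real.Gamma (β + 1) * ((y - x) ^ β + (y - x) ^ (β + 1)) := by
  have hΓ := Real.Gamma_pos_of_pos hβ
  have i1 := integrableOn_Ioo_rpow_sub hβ x y
  have i2 := integrableOn_Ioo_rpow_sub (show 0 < β + 1 by linarith) x y
  -- Writing t - x = (y-x) - (y-t) splits the majorant into pure powers of y - t.
  have hb : ‖∫ t in Ioo x y, (y - t) ^ (β - 1) * G t‖ ≤
      ∫ t in Ioo x y, ((1 + (β + 1) * (y - x)) * W * (y - t) ^ (β - 1) -
        (β + 1) * W * (y - t) ^ (β + 1 - 1)) := by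
    refine norm_integral_le_of_norm_le ((i1.const_mul _).sub (i2.const_mul _)) ?_
    refine (ae_restrict_iff' measurableSet_Ioo).2 (Eventually.of_forall fun t ht => ?_)
    have hp : 0 < y - t := sub_pos.2 ht.2
    rw [norm_mul, Real.norm_of_nonneg (Real.rpow_nonneg hp.le _), Real.norm_eq_abs]
    refine (mul_le_mul_of_nonneg_left (hG t (Ioo_subset_Icc_self ht))
      (Real.rpow_nonneg hp.le _)).trans_eq ?_
    rw [show β + 1 - 1 = (β - 1) + 1 by ring, Real.rpow_add_one hp.ne']
    ring
  rw [integral_sub (i1.const_mul _) (i2.const_mul _), integral_const_mul, integral_const_mul,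
    integral_Ioo_rpow_sub hβ hxy, integral_Ioo_rpow_sub (by linarith) hxy] at hb
  rw [abs_mul, abs_of_pos (by positivity)]
  refine (mul_le_mul_of_nonneg_left hb (by positivity)).trans_eq ?_
  have h0 : 0 ≤ y - x := sub_nonneg.2 hxy
  rw [Real.rpow_add_one' h0 (by positivity), Real.Gamma_add_one hβ.ne']
  field_simp
  ring

/-! ### The algebraic sigmoid and its density -/

lemma even_two_mul_pow_pos (m : ℕ) (x : ℝ) : 0 < 1 + x ^ (2 * m) := by
  have : 0 ≤ x ^ (2 * m) := by rw [pow_mul]; positivity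
  linarith

lemma algSigmoid_neg (m : ℕ) (x : ℝ) : algSigmoid m (-x) = -algSigmoid m x := by
  rw [algSigmoid, algSigmoid, Even.neg_pow (even_two_mul m), neg_div]

lemma algDensity_neg (m : ℕ) (x : ℝ) : algDensity m (-x) = algDensity m x := by
  rw [algDensity, algDensity, show -x + 1 = -(x - 1) by ring, show -x - 1 = -(x + 1) by ring,
    algSigmoid_neg, algSigmoid_neg]
  ring

lemma algSigmoid_nonneg (m : ℕ) {x : ℝ} (hx : 0 ≤ x) : 0 ≤ algSigmoid m x :=
  div_nonneg hx (Real.rpow_nonneg (even_two_mul_pow_pos m x).le _)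

/-- Cancelling x leaves a single power of 1 + x^(-2m), from which both monotonicity and the rate of
convergence to 1 can be read off. -/
lemma algSigmoid_of_pos {m : ℕ} (hm : 1 ≤ m) {x : ℝ} (hx : 0 < x) :
    algSigmoid m x = ((1 + (x⁻¹) ^ (2 * m)) ^ (1 / (2 * (m : ℝ))))⁻¹ := by
  have hm' : (0 : ℝ) < m := by exact_mod_cast hm
  have h : 1 + x ^ (2 * m) = x ^ (2 * m) * (1 + (x⁻¹) ^ (2 * m)) := by
    rw [mul_add, ← mul_pow, mul_inv_cancel₀ hx.ne', one_pow]; ring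
  have h2 : (x ^ (2 * m)) ^ (1 / (2 * (m : ℝ))) = x := by
    rw [one_div, ← Real.rpow_natCast, ← Real.rpow_mul hx.le]
    push_cast
    rw [mul_inv_cancel₀ (by positivity), Real.rpow_one]
  rw [algSigmoid, h, Real.mul_rpow (by positivity) (by positivity), h2]
  field_simp

lemma algSigmoid_mono_of_pos {m : ℕ} (hm : 1 ≤ m) {x y : ℝ} (hx : 0 < x) (hxy : x ≤ y) :
    algSigmoid m x ≤ algSigmoid m y := by
  have hy := hx.trans_le hxy
  rw [algSigmoid_of_pos hm hx, algSigmoid_of_pos hm hy]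
  gcongr

lemma algSigmoid_monotone {m : ℕ} (hm : 1 ≤ m) : Monotone (algSigmoid m) := by
  have h0 : algSigmoid m 0 = 0 := by simp [algSigmoid]
  have hnn : ∀ {x y : ℝ}, 0 ≤ x → x ≤ y → algSigmoid m x ≤ algSigmoid m y := fun {x y} hx hxy => by
    rcases hx.eq_or_lt with rfl | hx
    · rw [h0]; exact algSigmoid_nonneg m hxy
    · exact algSigmoid_mono_of_pos hm hx hxy
  intro x y hxy
  rcases le_total 0 x with hx | hx
  · exact hnn hx hxy
  · rcases le_total 0 y with hy | hy
    · have := algSigmoid_nonneg m (neg_nonneg.2 hx)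
      rw [algSigmoid_neg] at this
      exact (by linarith : algSigmoid m x ≤ 0).trans (algSigmoid_nonneg m hy)
    · have := hnn (neg_nonneg.2 hy) (neg_le_neg hxy)
      rw [algSigmoid_neg, algSigmoid_neg] at this
      linarith

lemma algSigmoid_le_one {m : ℕ} (hm : 1 ≤ m) (x : ℝ) : algSigmoid m x ≤ 1 := by
  have hpos : 0 < max x 1 := lt_max_of_lt_right one_pos
  refine (algSigmoid_monotone hm (le_max_left x 1)).trans ?_
  rw [algSigmoid_of_pos hm hpos]
  refine inv_le_one_of_one_le₀ (Real.one_le_rpow ?_ (by positivity))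
  have : 0 ≤ (max x 1)⁻¹ ^ (2 * m) := by positivity
  linarith

lemma algDensity_nonneg {m : ℕ} (hm : 1 ≤ m) (x : ℝ) : 0 ≤ algDensity m x := by
  have := algSigmoid_monotone hm (show x - 1 ≤ x + 1 by linarith)
  rw [algDensity]
  linarith

/-- φ(w) is w times a factor decreasing in w ≥ 0, hence subadditive there. -/
lemma algSigmoid_add_le (m : ℕ) {u v : ℝ} (hu : 0 ≤ u) (hv : 0 ≤ v) :
    algSigmoid m (u + v) ≤ algSigmoid m u + algSigmoid m v := by
  have hp : ∀ x : ℝ, 0 < (1 + x ^ (2 * m)) ^ (1 / (2 * (m : ℝ))) := fun x =>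
    Real.rpow_pos_of_pos (even_two_mul_pow_pos m x) _
  have key : ∀ {w : ℝ}, 0 ≤ w → w ≤ u + v →
      w / (1 + (u + v) ^ (2 * m)) ^ (1 / (2 * (m : ℝ))) ≤ algSigmoid m w := fun {w} hw hle => by
    rw [algSigmoid]
    refine div_le_div_of_nonneg_left hw (hp w) ?_
    exact Real.rpow_le_rpow (even_two_mul_pow_pos m w).le (by gcongr) (by positivity)
  rw [algSigmoid, add_div]
  exact add_le_add (key hu (by linarith)) (key hv (by linarith))

/-- By oddness 4Φ(t) = φ(1+t) + φ(1-t), with both arguments nonnegative and of sum 2; subadditivity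
gives at least φ(2). -/
lemma algDensity_lower {m : ℕ} {t : ℝ} (ht : |t| ≤ 1) :
    1 / (2 * (1 + (4 : ℝ) ^ m) ^ (1 / (2 * (m : ℝ)))) ≤ algDensity m t := by
  obtain ⟨h1, h2⟩ := abs_le.1 ht
  have h := algSigmoid_add_le m (show 0 ≤ t + 1 by linarith) (show 0 ≤ 1 - t by linarith)
  have h3 : algSigmoid m (1 - t) = -algSigmoid m (t - 1) := by
    rw [← algSigmoid_neg, neg_sub]
  rw [show t + 1 + (1 - t) = 2 by ring, h3, algSigmoid, pow_mul,
    show (2 : ℝ) ^ 2 = 4 by norm_num] at h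
  have hp : 0 < (1 + (4 : ℝ) ^ m) ^ (1 / (2 * (m : ℝ))) := by positivity
  rw [algDensity]
  calc _ = (1 / 4) * (2 / (1 + (4 : ℝ) ^ m) ^ (1 / (2 * (m : ℝ)))) := by field_simp; norm_num
    _ ≤ _ := by linarith

/-- With φ(s) = 1/A and A ≥ 1, 1 - 1/A ≤ A - 1, and Bernoulli's inequality with exponent 1/(2m) ≤ 1
bounds A - 1. -/
lemma one_sub_algSigmoid_le {m : ℕ} (hm : 1 ≤ m) {s : ℝ} (hs : 0 < s) :
    1 - algSigmoid m s ≤ 1 / (2 * (m : ℝ) * s ^ (2 * m)) := by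
  have hm' : (1 : ℝ) ≤ m := by exact_mod_cast hm
  have hu : 0 < (s⁻¹) ^ (2 * m) := by positivity
  have hp1 : 1 / (2 * (m : ℝ)) ≤ 1 := by rw [div_le_one (by positivity)]; linarith
  have hB := rpow_one_add_le_one_add_mul_self (s := (s⁻¹) ^ (2 * m)) (by linarith)
    (p := 1 / (2 * (m : ℝ))) (by positivity) hp1
  rw [algSigmoid_of_pos hm hs]
  set A := (1 + (s⁻¹) ^ (2 * m)) ^ (1 / (2 * (m : ℝ)))
  have hA : 1 ≤ A := Real.one_le_rpow (by linarith) (by positivity)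
  have h1 : 1 - A⁻¹ ≤ A - 1 := by
    rw [show 1 - A⁻¹ = (A - 1) / A by field_simp]
    exact div_le_self (by linarith) hA
  have h2 : 1 / (2 * (m : ℝ)) * (s⁻¹) ^ (2 * m) = 1 / (2 * (m : ℝ) * s ^ (2 * m)) := by
    rw [inv_pow]; field_simp
  linarith

/-- The density is a difference of φ with step 2, so the sum telescopes to two terms at each end. -/
lemma sum_Icc_algDensity (m : ℕ) (t : ℝ) (p : ℤ) (j : ℕ) :
    ∑ k ∈ Finset.Icc p (p + j), algDensity m (t - k) =
      (1 / 4) * (algSigmoid m (t - p + 1) + algSigmoid m (t - p) -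
        algSigmoid m (t - (p + j)) - algSigmoid m (t - (p + j) - 1)) := by
  induction j with
  | zero => simp [algDensity]
  | succ j ih =>
    have h : Finset.Icc p (p + (j + 1 : ℕ)) = insert (p + (j : ℤ) + 1) (Finset.Icc p (p + j)) := by
      ext k; simp only [Finset.mem_Icc, Finset.mem_insert]; push_cast; omega
    rw [h, Finset.sum_insert (by simp), ih, algDensity]
    push_cast
    ring_nf

lemma sum_algDensity_le {m : ℕ} (hm : 1 ≤ m) (t M : ℝ) (s : Finset ℤ)
    (hs : ∀ k ∈ s, M ≤ t - k) :
    ∑ k ∈ s, algDensity m (t - k) ≤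
      (1 / 4) * (2 - algSigmoid m M - algSigmoid m (M - 1)) := by
  rcases s.eq_empty_or_nonempty with rfl | hne
  · have := algSigmoid_le_one hm M
    have := algSigmoid_le_one hm (M - 1)
    simp only [Finset.sum_empty]
    linarith
  · set p := s.min' hne
    set q := s.max' hne
    have hpq : p ≤ q := s.min'_le_max' hne
    obtain ⟨j, hj⟩ := Int.eq_ofNat_of_zero_le (sub_nonneg.2 hpq)
    have hq : q = p + j := by omega
    -- Filling the gaps of s only increases the sum and, as the largest index is kept, preserves the
    -- bound by M.
    have hsub : s ⊆ Finset.Icc p (p + j) := fun k hk =>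
      Finset.mem_Icc.2 ⟨s.min'_le k hk, hq ▸ s.le_max' k hk⟩
    refine (Finset.sum_le_sum_of_subset_of_nonneg hsub
      fun k _ _ => algDensity_nonneg hm _).trans ?_
    rw [sum_Icc_algDensity]
    have hM : M ≤ t - (p + j) := by
      have := hs q (s.max'_mem hne)
      rw [hq] at this
      push_cast at this
      exact this
    have h1 := algSigmoid_monotone hm hM
    have h2 := algSigmoid_monotone hm (sub_le_sub_right hM 1)
    have h3 := algSigmoid_le_one hm (t - p + 1)
    have h4 := algSigmoid_le_one hm (t - p)
    linarith

lemma sum_algDensity_tail_le {m : ℕ} (hm : 1 ≤ m) {t M : ℝ} (hM : 2 < M) (s : Finset ℤ)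
    (hs : ∀ k ∈ s, M ≤ t - k) :
    ∑ k ∈ s, algDensity m (t - k) ≤ 1 / (4 * (m : ℝ) * (M - 2) ^ (2 * m)) := by
  have hm' : (0 : ℝ) < m := by exact_mod_cast hm
  have hM2 : 0 < M - 2 := by linarith
  have key : ∀ {s : ℝ}, M - 2 ≤ s → 1 - algSigmoid m s ≤ 1 / (2 * (m : ℝ) * (M - 2) ^ (2 * m)) :=
    fun {s} h => (one_sub_algSigmoid_le hm (hM2.trans_le h)).trans (by gcongr)
  refine (sum_algDensity_le hm t M s hs).trans ?_
  have h1 := key (show M - 2 ≤ M by linarith)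
  have h2 := key (show M - 2 ≤ M - 1 by linarith)
  have h3 : 1 / (4 * (m : ℝ) * (M - 2) ^ (2 * m)) =
      (1 / 2) * (1 / (2 * (m : ℝ) * (M - 2) ^ (2 * m))) := by field_simp; norm_num
  have h4 : 0 ≤ 1 / (2 * (m : ℝ) * (M - 2) ^ (2 * m)) := by positivity
  rw [h3]
  linarith

lemma sum_algDensity_tail_le' {m : ℕ} (hm : 1 ≤ m) {t M : ℝ} (hM : 2 < M) (s : Finset ℤ)
    (hs : ∀ k ∈ s, t - k ≤ -M) :
    ∑ k ∈ s, algDensity m (t - k) ≤ 1 / (4 * (m : ℝ) * (M - 2) ^ (2 * m)) := by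
  have h := sum_algDensity_tail_le hm (t := -t) hM (s.image Neg.neg) (fun k hk => by
    obtain ⟨l, hl, rfl⟩ := Finset.mem_image.1 hk
    have := hs l hl
    push_cast
    linarith)
  rw [Finset.sum_image (fun _ _ _ _ => neg_inj.1)] at h
  refine (Finset.sum_congr rfl fun k _ => ?_).trans_le h
  rw [← algDensity_neg]
  push_cast
  ring_nf

/-- The tail of the density sum is controlled by the full sum: a two-sided tail can only occur when
both integer neighbours of `t` are summation indices. -/
lemma sum_algDensity_filter_le {m : ℕ} (hm : 1 ≤ m) {t M : ℝ} (hM : 2 < M) {p q : ℤ}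
    (hnear : ∃ k ∈ Finset.Icc p q, |t - k| ≤ 1) :
    ∑ k ∈ (Finset.Icc p q).filter (fun k : ℤ => M ≤ |t - k|), algDensity m (t - k) ≤
      2 * (1 + (4 : ℝ) ^ m) ^ (1 / (2 * (m : ℝ))) *
        (∑ k ∈ Finset.Icc p q, algDensity m (t - k)) *
        (1 / (4 * (m : ℝ) * (M - 2) ^ (2 * m))) := by
  have hm' : (0 : ℝ) < m := by exact_mod_cast hm
  have hM2 : 0 < M - 2 := by linarith
  set T := 1 / (4 * (m : ℝ) * (M - 2) ^ (2 * m))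
  have hT : 0 ≤ T := by positivity
  set C := 2 * (1 + (4 : ℝ) ^ m) ^ (1 / (2 * (m : ℝ))) with hCdef
  have hC : 0 < C := by positivity
  set s := Finset.Icc p q
  set R := s.filter (fun k : ℤ => M ≤ t - k)
  set L := s.filter (fun k : ℤ => t - k ≤ -M)
  have hsplit : ∑ k ∈ s.filter (fun k : ℤ => M ≤ |t - k|), algDensity m (t - k) ≤
      ∑ k ∈ R, algDensity m (t - k) + ∑ k ∈ L, algDensity m (t - k) := by
    rw [← Finset.sum_union_inter]
    have hsub : s.filter (fun k : ℤ => M ≤ |t - k|) ⊆ R ∪ L := fun k hk => by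
      rw [Finset.mem_filter, le_abs'] at hk
      rcases hk with ⟨hk, h | h⟩
      · exact Finset.mem_union_right _ (Finset.mem_filter.2 ⟨hk, h⟩)
      · exact Finset.mem_union_left _ (Finset.mem_filter.2 ⟨hk, h⟩)
    have h1 := Finset.sum_le_sum_of_subset_of_nonneg hsub
      fun k _ _ => algDensity_nonneg hm (t - (k : ℝ))
    have h2 : 0 ≤ ∑ k ∈ R ∩ L, algDensity m (t - k) :=
      Finset.sum_nonneg fun k _ => algDensity_nonneg hm _
    linarith
  have hR : ∑ k ∈ R, algDensity m (t - k) ≤ T :=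
    sum_algDensity_tail_le hm hM R fun k hk => (Finset.mem_filter.1 hk).2
  have hL : ∑ k ∈ L, algDensity m (t - k) ≤ T :=
    sum_algDensity_tail_le' hm hM L fun k hk => (Finset.mem_filter.1 hk).2
  -- One node within distance 1 of t suffices when only one tail is present.
  have hone : 1 ≤ C * ∑ k ∈ s, algDensity m (t - k) := by
    obtain ⟨k, hk, hk1⟩ := hnear
    have h1 := (algDensity_lower (m := m) hk1).trans
      (Finset.single_le_sum (f := fun k : ℤ => algDensity m (t - k))
        (fun k _ => algDensity_nonneg hm _) hk)
    rwa [div_le_iff₀' hC] at h1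
  rcases R.eq_empty_or_nonempty with hRe | ⟨k₁, hk₁⟩
  · rw [hRe, Finset.sum_empty, zero_add] at hsplit
    exact (hsplit.trans hL).trans (le_mul_of_one_le_left hT hone)
  rcases L.eq_empty_or_nonempty with hLe | ⟨k₂, hk₂⟩
  · rw [hLe, Finset.sum_empty, add_zero] at hsplit
    exact (hsplit.trans hR).trans (le_mul_of_one_le_left hT hone)
  -- Indices on both sides of t force ⌊t⌋ and ⌊t⌋ + 1 into the range; each contributes at least 1/C,
  -- which pays for the second tail.
  have htwo : 2 ≤ C * ∑ k ∈ s, algDensity m (t - k) := by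
    obtain ⟨h1s, h1⟩ := Finset.mem_filter.1 hk₁
    obtain ⟨h2s, h2⟩ := Finset.mem_filter.1 hk₂
    rw [Finset.mem_Icc] at h1s h2s
    have hf := Int.floor_le t
    have hf' := Int.lt_floor_add_one t
    have hlo : k₁ ≤ ⌊t⌋ := Int.le_floor.2 (by linarith)
    have hhi : ⌊t⌋ + 1 ≤ k₂ := by
      have : (⌊t⌋ : ℝ) < k₂ := by linarith
      exact_mod_cast this
    have hsub : {⌊t⌋, ⌊t⌋ + 1} ⊆ s := fun k hk => by
      simp only [Finset.mem_insert, Finset.mem_singleton] at hk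
      exact Finset.mem_Icc.2 ⟨by omega, by omega⟩
    have h3 := Finset.sum_le_sum_of_subset_of_nonneg hsub
      fun k _ _ => algDensity_nonneg hm (t - (k : ℝ))
    rw [Finset.sum_pair (by omega)] at h3
    have h4 := algDensity_lower (m := m) (t := t - ⌊t⌋) (abs_le.2 ⟨by linarith, by linarith⟩)
    have h5 := algDensity_lower (m := m) (t := t - (⌊t⌋ + 1 : ℤ))
      (abs_le.2 ⟨by push_cast; linarith, by push_cast; linarith⟩)
    have h6 : 2 * (1 / C) ≤ ∑ k ∈ s, algDensity m (t - k) := by linarith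
    calc (2 : ℝ) = C * (2 * (1 / C)) := by field_simp
      _ ≤ _ := mul_le_mul_of_nonneg_left h6 hC.le
  calc _ ≤ 2 * T := by linarith
    _ ≤ _ := mul_le_mul_of_nonneg_right htwo hT

/-! ### Modulus of continuity -/

lemma bddAbove_modulusOn {g : ℝ → ℝ} {s : Set ℝ} (hs : IsCompact s) (hg : ContinuousOn g s)
    (δ : ℝ) :
    BddAbove {r : ℝ | ∃ u ∈ s, ∃ v ∈ s, |u - v| ≤ δ ∧ r = |g u - g v|} := by
  obtain ⟨C, hC⟩ := hs.exists_bound_of_continuousOn hg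
  refine ⟨C + C, ?_⟩
  rintro r ⟨u, hu, v, hv, -, rfl⟩
  exact (norm_sub_le (g u) (g v)).trans (add_le_add (hC u hu) (hC v hv))

lemma modulusOn_nonneg (g : ℝ → ℝ) (s : Set ℝ) (δ : ℝ) : 0 ≤ modulusOn g s δ := by
  refine Real.sSup_nonneg ?_
  rintro r ⟨u, -, v, -, -, rfl⟩
  exact abs_nonneg _

/-- Chaining: a segment of length at most jδ is cut into j steps of length at most δ, which
convexity keeps inside s. -/
lemma abs_sub_le_natCast_mul_modulusOn {g : ℝ → ℝ} {s : Set ℝ} {δ : ℝ} (hs : IsCompact s)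
    (hconv : Convex ℝ s) (hg : ContinuousOn g s) (j : ℕ) :
    ∀ u ∈ s, ∀ v ∈ s, |u - v| ≤ j * δ → |g u - g v| ≤ j * modulusOn g s δ := by
  induction j with
  | zero =>
    intro u _ v _ h
    have : u = v := by
      rw [Nat.cast_zero, zero_mul] at h
      exact sub_eq_zero.1 (abs_nonpos_iff.1 h)
    simp [this]
  | succ j ih =>
    intro u hu v hv h
    push_cast at h ⊢
    have hj : (0 : ℝ) < j + 1 := by positivity
    -- The point at 1/(j+1) of the way from v to u: one step from v, j steps from u.
    set w := (j / ((j : ℝ) + 1)) * v + (1 / ((j : ℝ) + 1)) * u with hw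
    have hws : w ∈ s := hconv hv hu (by positivity) (by positivity) (by field_simp)
    have h1 : |u - w| ≤ j * δ := by
      rw [show u - w = (j / ((j : ℝ) + 1)) * (u - v) by rw [hw]; field_simp; ring, abs_mul,
        abs_of_nonneg (by positivity)]
      calc _ ≤ (j / ((j : ℝ) + 1)) * ((j + 1) * δ) := by gcongr
        _ = j * δ := by field_simp
    have h2 : |w - v| ≤ δ := by
      rw [show w - v = (1 / ((j : ℝ) + 1)) * (u - v) by rw [hw]; field_simp; ring, abs_mul,
        abs_of_nonneg (by positivity)]
      calc _ ≤ (1 / ((j : ℝ) + 1)) * ((j + 1) * δ) := by gcongr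
        _ = δ := by field_simp
    have h3 : |g w - g v| ≤ modulusOn g s δ :=
      le_csSup (bddAbove_modulusOn hs hg δ) ⟨w, hws, v, hv, h2, rfl⟩
    have h4 := abs_sub_le (g u) (g w) (g v)
    have h5 := ih u hu w hws h1
    linarith

lemma abs_sub_le_modulusOn {g : ℝ → ℝ} {s : Set ℝ} {δ u v : ℝ} (hs : IsCompact s)
    (hconv : Convex ℝ s) (hg : ContinuousOn g s) (hδ : 0 < δ) (hu : u ∈ s) (hv : v ∈ s) :
    |g u - g v| ≤ (1 + |u - v| / δ) * modulusOn g s δ := by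
  refine (abs_sub_le_natCast_mul_modulusOn (δ := δ) hs hconv hg ⌈|u - v| / δ⌉₊ u hu v hv ?_).trans ?_
  · rw [← div_le_iff₀ hδ]
    exact Nat.le_ceil _
  · refine mul_le_mul_of_nonneg_right ?_ (modulusOn_nonneg g s δ)
    linarith [Nat.ceil_lt_add_one (show 0 ≤ |u - v| / δ by positivity)]

/-! ### Estimates from the Taylor formula -/

open Set in
lemma rightCaputo_eq_leftCaputo (α x : ℝ) (g : ℝ → ℝ) (y : ℝ) :
    rightCaputo α x g y = leftCaputo α (-x) (fun t => g (-t)) (-y) := by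
  rw [rightCaputo, leftCaputo]
  rcases le_total x y with h | h
  · simp [h]
  · rw [← intervalIntegral.integral_of_le h, ← intervalIntegral.integral_of_le (neg_le_neg h)]
    have := intervalIntegral.integral_comp_neg (a := -x) (b := -y)
      (fun z => (z - y) ^ (-α) * deriv g z)
    rw [neg_neg, neg_neg] at this
    -- The minus sign in the right derivative is absorbed by the one from differentiating g(-t).
    rw [← this, neg_div, neg_mul, ← mul_neg, ← intervalIntegral.integral_neg]
    congr 1
    refine intervalIntegral.integral_congr fun t _ => ?_
    simp only [deriv_comp_neg]
    rw [show -t - y = -y - t by ring]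
    ring

lemma iterLeftCaputo_comp_neg (α x : ℝ) (k : ℕ) (f : ℝ → ℝ) :
    iterLeftCaputo α (-x) k (fun t => f (-t)) = fun t => iterRightCaputo α x k f (-t) := by
  induction k with
  | zero => rfl
  | succ k ih =>
    ext t
    rw [iterLeftCaputo_succ, ih, show iterRightCaputo α x (k + 1) f =
      rightCaputo α x (iterRightCaputo α x k f) from Function.iterate_succ_apply' _ _ _,
      rightCaputo_eq_leftCaputo, neg_neg]

-- Absolute continuity enters only through integrability of the derivative and the fundamental
-- theorem of calculus; both pass directly to the reflected function in the right-hand case.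
open Set in
lemma abs_sub_le_of_iterLeftCaputo {α x b W : ℝ} {f : ℝ → ℝ} {N : ℕ} (hα0 : 0 < α) (hα1 : α < 1)
    (hi : ∀ k ≤ N, ∀ y ∈ Icc x b,
      IntervalIntegrable (deriv (iterLeftCaputo α x k f)) volume x y)
    (hftc : ∀ k ≤ N, ∀ y ∈ Icc x b, ∫ t in x..y, deriv (iterLeftCaputo α x k f) t =
      iterLeftCaputo α x k f y - iterLeftCaputo α x k f x)
    (hc : ∀ k ≤ N + 1, ContinuousOn (iterLeftCaputo α x k f) (Icc x b))
    (hW : ∀ t ∈ Icc x b, |iterLeftCaputo α x (N + 1) f t - iterLeftCaputo α x (N + 1) f x| ≤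
      (1 + (((N : ℝ) + 1) * α + 1) * |t - x|) * W) {y : ℝ} (hy : y ∈ Icc x b) :
    |f y - f x| ≤ W / Real.Gamma (((N : ℝ) + 1) * α + 1) *
      (|y - x| ^ (((N : ℝ) + 1) * α) + |y - x| ^ (((N : ℝ) + 1) * α + 1)) := by
  rw [sub_eq_integral_iterLeftCaputo hα0 hα1 hi hftc hc N le_rfl y hy,
    abs_of_nonneg (sub_nonneg.2 hy.1)]
  refine abs_integral_rpow_mul_le (by positivity) hy.1 fun t ht => ?_
  have := hW t ⟨ht.1, ht.2.trans hy.2⟩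
  rwa [iterLeftCaputo_succ_self, sub_zero, abs_of_nonneg (sub_nonneg.2 ht.1)] at this

open Set in
lemma abs_sub_le_of_iterLeftCaputo_of_absolutelyContinuous {α x b W : ℝ} {f : ℝ → ℝ} {N : ℕ}
    (hα0 : 0 < α) (hα1 : α < 1)
    (hac : ∀ k ≤ N, AbsolutelyContinuousOnInterval (iterLeftCaputo α x k f) x b)
    (hc : ∀ k ≤ N + 1, ContinuousOn (iterLeftCaputo α x k f) (Icc x b))
    (hW : ∀ t ∈ Icc x b, |iterLeftCaputo α x (N + 1) f t - iterLeftCaputo α x (N + 1) f x| ≤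
      (1 + (((N : ℝ) + 1) * α + 1) * |t - x|) * W) {y : ℝ} (hy : y ∈ Icc x b) :
    |f y - f x| ≤ W / Real.Gamma (((N : ℝ) + 1) * α + 1) *
      (|y - x| ^ (((N : ℝ) + 1) * α) + |y - x| ^ (((N : ℝ) + 1) * α + 1)) := by
  have hac' : ∀ k ≤ N, ∀ y ∈ Icc x b,
      AbsolutelyContinuousOnInterval (iterLeftCaputo α x k f) x y := fun k hk y hy =>
    (hac k hk).mono (by
      rw [uIcc_of_le hy.1, uIcc_of_le (hy.1.trans hy.2)]
      exact Icc_subset_Icc_right hy.2)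
  exact abs_sub_le_of_iterLeftCaputo hα0 hα1
    (fun k hk y hy => (hac' k hk y hy).intervalIntegrable_deriv)
    (fun k hk y hy => (hac' k hk y hy).integral_deriv_eq_sub) hc hW hy

open Set in
lemma abs_sub_le_of_iterRightCaputo_of_absolutelyContinuous {α a x W : ℝ} {f : ℝ → ℝ} {N : ℕ}
    (hα0 : 0 < α) (hα1 : α < 1)
    (hac : ∀ k ≤ N, AbsolutelyContinuousOnInterval (iterRightCaputo α x k f) a x)
    (hc : ∀ k ≤ N + 1, ContinuousOn (iterRightCaputo α x k f) (Icc a x))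
    (hW : ∀ t ∈ Icc a x, |iterRightCaputo α x (N + 1) f t - iterRightCaputo α x (N + 1) f x| ≤
      (1 + (((N : ℝ) + 1) * α + 1) * |t - x|) * W) {y : ℝ} (hy : y ∈ Icc a x) :
    |f y - f x| ≤ W / Real.Gamma (((N : ℝ) + 1) * α + 1) *
      (|y - x| ^ (((N : ℝ) + 1) * α) + |y - x| ^ (((N : ℝ) + 1) * α + 1)) := by
  have hmem : ∀ {t : ℝ}, t ∈ Icc (-x) (-a) → -t ∈ Icc a x := fun {t} ht =>
    ⟨by linarith [ht.2], by linarith [ht.1]⟩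
  have hac' : ∀ k ≤ N, ∀ y ∈ Icc (-x) (-a),
      AbsolutelyContinuousOnInterval (iterRightCaputo α x k f) (-y) x := fun k hk y hy =>
    (hac k hk).mono (by
      rw [uIcc_of_le (hmem hy).2, uIcc_of_le ((hmem hy).1.trans (hmem hy).2)]
      exact Icc_subset_Icc_left (hmem hy).1)
  have hd : ∀ k, deriv (iterLeftCaputo α (-x) k (fun t => f (-t))) =
      fun t => -deriv (iterRightCaputo α x k f) (-t) := fun k => by
    ext t
    rw [iterLeftCaputo_comp_neg, deriv_comp_neg]
  have h := abs_sub_le_of_iterLeftCaputo (f := fun t => f (-t)) (x := -x) (b := -a) (N := N)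
    (W := W) hα0 hα1
    (fun k hk y hy => by
      have h := ((hac' k hk y hy).intervalIntegrable_deriv.symm.comp_sub_left 0).neg
      simp only [zero_sub, neg_neg] at h
      rw [hd]
      exact h)
    (fun k hk y hy => by
      rw [hd, intervalIntegral.integral_neg,
        intervalIntegral.integral_comp_neg (fun t => deriv (iterRightCaputo α x k f) t), neg_neg,
        (hac' k hk y hy).integral_deriv_eq_sub, iterLeftCaputo_comp_neg]
      simp only [neg_neg, neg_sub])
    (fun k hk => by
      rw [iterLeftCaputo_comp_neg]
      exact (hc k hk).comp continuous_neg.continuousOn fun t ht => hmem ht)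
    (fun t ht => by
      have := hW (-t) (hmem ht)
      rw [iterLeftCaputo_comp_neg]
      simp only [neg_neg (x : ℝ)]
      rwa [← abs_neg (-t - x), show -(-t - x) = t - -x by ring] at this)
    (y := -y) ⟨neg_le_neg hy.2, neg_le_neg hy.1⟩
  rw [← abs_neg (y - x), show -(y - x) = -y - -x by ring]
  simpa only [neg_neg] using h

/-! ### Convergence of the operators -/

lemma exists_int_near {a b x : ℝ} {n : ℕ} (hx : x ∈ Set.Icc a b)
    (hab : ⌈(n : ℝ) * a⌉ ≤ ⌊(n : ℝ) * b⌋) :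
    ∃ k ∈ Finset.Icc ⌈(n : ℝ) * a⌉ ⌊(n : ℝ) * b⌋, |(n : ℝ) * x - k| ≤ 1 := by
  have h1 : (n : ℝ) * a ≤ n * x := by gcongr; exact hx.1
  have h2 : (n : ℝ) * x ≤ n * b := by gcongr; exact hx.2
  rcases le_or_gt ⌈(n : ℝ) * a⌉ ⌊(n : ℝ) * x⌋ with h | h
  · refine ⟨⌊(n : ℝ) * x⌋, Finset.mem_Icc.2 ⟨h, Int.floor_mono h2⟩, ?_⟩
    rw [abs_le]
    constructor <;> linarith [Int.floor_le ((n : ℝ) * x), Int.lt_floor_add_one ((n : ℝ) * x)]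
  -- Here na ≤ nx < ⌈na⌉ < na + 1, so the first node is close enough.
  · refine ⟨⌈(n : ℝ) * a⌉, Finset.mem_Icc.2 ⟨le_rfl, hab⟩, ?_⟩
    have h3 := Int.floor_lt.1 h
    rw [abs_le]
    constructor <;> linarith [Int.ceil_lt_add_one ((n : ℝ) * a)]

lemma abs_nnOperator_sub_le {m : ℕ} (hm : 1 ≤ m) {a b x M P Q : ℝ} {n : ℕ} {f : ℝ → ℝ}
    (hn : 0 < n) (hx : x ∈ Set.Icc a b) (hab : ⌈(n : ℝ) * a⌉ ≤ ⌊(n : ℝ) * b⌋) (hM : 2 < M)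
    (hP : 0 ≤ P) (hQ : 0 ≤ Q)
    (hnear : ∀ y ∈ Set.Icc a b, n * |y - x| < M → |f y - f x| ≤ P)
    (hfar : ∀ y ∈ Set.Icc a b, |f y - f x| ≤ Q) :
    |nnOperator m a b n f x - f x| ≤ 2 * (1 + (4 : ℝ) ^ m) ^ (1 / (2 * (m : ℝ))) *
      (P + Q * (1 / (4 * (m : ℝ) * (M - 2) ^ (2 * m)))) := by
  have hn' : (0 : ℝ) < n := by exact_mod_cast hn
  have hk := exists_int_near hx hab
  have htail := sum_algDensity_filter_le hm hM hk
  set s := Finset.Icc ⌈(n : ℝ) * a⌉ ⌊(n : ℝ) * b⌋ with hs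
  set T := 1 / (4 * (m : ℝ) * (M - 2) ^ (2 * m))
  set C := 2 * (1 + (4 : ℝ) ^ m) ^ (1 / (2 * (m : ℝ))) with hCdef
  have hC : 1 ≤ C := by
    have : 1 ≤ (1 + (4 : ℝ) ^ m) ^ (1 / (2 * (m : ℝ))) :=
      Real.one_le_rpow (by linarith [show 0 < (4 : ℝ) ^ m by positivity]) (by positivity)
    linarith
  set Φ : ℤ → ℝ := fun k => algDensity m ((n : ℝ) * x - k)
  have hΦ : ∀ k, 0 ≤ Φ k := fun k => algDensity_nonneg hm _
  set S := ∑ k ∈ s, Φ k with hS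
  have hSpos : 0 < S := by
    obtain ⟨k, hks, hk1⟩ := hk
    have h1 := (algDensity_lower (m := m) hk1).trans (Finset.single_le_sum (fun k _ => hΦ k) hks)
    exact (by positivity : 0 < 1 / C).trans_le h1
  have hmem : ∀ k ∈ s, (k : ℝ) / n ∈ Set.Icc a b := fun k hk => by
    obtain ⟨h1, h2⟩ := Finset.mem_Icc.1 hk
    constructor
    · rw [le_div_iff₀' hn']; exact Int.ceil_le.1 h1
    · rw [div_le_iff₀' hn']; exact Int.le_floor.1 h2
  have hdist : ∀ k : ℤ, (n : ℝ) * |(k : ℝ) / n - x| = |(n : ℝ) * x - k| := fun k => by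
    rw [abs_sub_comm ((n : ℝ) * x), ← abs_of_pos hn', ← abs_mul, abs_of_pos hn']
    congr 1
    field_simp
  -- P is charged to every node and Q only to the far ones, so the near part needs no separate sum.
  have hterm : ∀ k ∈ s, |(f ((k : ℝ) / n) - f x) * Φ k| ≤
      P * Φ k + if M ≤ |(n : ℝ) * x - k| then Q * Φ k else 0 := fun k hk => by
    rw [abs_mul, abs_of_nonneg (hΦ k)]
    split_ifs with h
    · have h1 := mul_le_mul_of_nonneg_right (hfar _ (hmem k hk)) (hΦ k)
      have h2 := mul_nonneg hP (hΦ k)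
      linarith
    · rw [add_zero]
      refine mul_le_mul_of_nonneg_right (hnear _ (hmem k hk) ?_) (hΦ k)
      rw [hdist]
      exact not_le.1 h
  have hsum : |∑ k ∈ s, (f ((k : ℝ) / n) - f x) * Φ k| ≤ C * (P + Q * T) * S := by
    refine (Finset.abs_sum_le_sum_abs _ _).trans ((Finset.sum_le_sum hterm).trans ?_)
    rw [Finset.sum_add_distrib, ← Finset.mul_sum, ← Finset.sum_filter, ← Finset.mul_sum]
    have h1 := mul_le_mul_of_nonneg_left htail hQ
    have h2 : P * S ≤ C * (P * S) := le_mul_of_one_le_left (by positivity) hC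
    calc _ ≤ C * (P * S) + Q * (C * S * T) := add_le_add h2 h1
      _ = _ := by ring
  have heq : nnOperator m a b n f x - f x = (∑ k ∈ s, (f ((k : ℝ) / n) - f x) * Φ k) / S := by
    rw [nnOperator, ← hs, eq_div_iff hSpos.ne', sub_mul]
    simp_rw [sub_mul]
    rw [Finset.sum_sub_distrib, ← Finset.mul_sum, div_mul_cancel₀ _ hSpos.ne']
  rw [heq, abs_div, abs_of_pos hSpos, div_le_iff₀ hSpos]
  exact hsum

lemma eventually_ceil_le_floor {a b : ℝ} (hab : a < b) :
    ∀ᶠ n : ℕ in atTop, ⌈(n : ℝ) * a⌉ ≤ ⌊(n : ℝ) * b⌋ := by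
  have h := (tendsto_natCast_atTop_atTop (R := ℝ)).atTop_mul_const (sub_pos.2 hab)
  filter_upwards [h.eventually_ge_atTop 1] with n hn
  refine Int.le_floor.2 ?_
  linarith [Int.ceil_lt_add_one ((n : ℝ) * a)]

theorem corollary38
    (a b : ℝ) (hab : a < b)
    (α : ℝ) (hα0 : 0 < α) (hα1 : α < 1)
    (m : ℕ) (hm : 1 ≤ m)
    (N : ℕ) (hN : 1 ≤ N)
    (f : ℝ → ℝ)
    (hfc : ContinuousOn f (Set.Icc a b))
    -- `f' ∈ L_∞([a, b])`
    (hfac : AbsolutelyContinuousOnInterval f a b)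
    (hf' : MemLp (deriv f) ⊤ (volume.restrict (Set.Icc a b)))
    (x : ℝ) (hx : x ∈ Set.Icc a b)
    -- the iterated derivatives up to order `N + 1` are defined
    (hLac : ∀ k ≤ N, AbsolutelyContinuousOnInterval (iterLeftCaputo α x k f) x b)
    (hRac : ∀ k ≤ N, AbsolutelyContinuousOnInterval (iterRightCaputo α x k f) a x)
    (hLc : ∀ k ≤ N + 1, ContinuousOn (iterLeftCaputo α x k f) (Set.Icc x b))
    (hL0 : ∀ i, 2 ≤ i → i ≤ N + 1 → iterLeftCaputo α x i f x = 0)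
    (hRc : ∀ k ≤ N + 1, ContinuousOn (iterRightCaputo α x k f) (Set.Icc a x))
    (hR0 : ∀ i, 2 ≤ i → i ≤ N + 1 → iterRightCaputo α x i f x = 0) :
    (∀ n : ℕ, 2 < (n : ℝ) ^ (1 - α) → ⌈(n : ℝ) * a⌉ ≤ ⌊(n : ℝ) * b⌋ →
      |nnOperator m a b n f x - f x| ≤
        2 * (1 + (4 : ℝ) ^ m) ^ (1 / (2 * (m : ℝ))) *
            iterModulus α a b x (N + 1) f (1 / (((N : ℝ) + 1) * α + 1)) /
          Real.Gamma (((N : ℝ) + 1) * α + 1) *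
        ((1 / (n : ℝ) ^ (((N : ℝ) + 1) * α ^ 2) +
            (b - a) ^ (((N : ℝ) + 1) * α) /
              (4 * (m : ℝ) * ((n : ℝ) ^ (1 - α) - 2) ^ (2 * m))) +
          (1 / (n : ℝ) ^ (α * (((N : ℝ) + 1) * α + 1)) +
            (b - a) ^ (((N : ℝ) + 1) * α + 1) /
              (4 * (m : ℝ) * ((n : ℝ) ^ (1 - α) - 2) ^ (2 * m))))) ∧
    Tendsto (fun n : ℕ => nnOperator m a b n f x) atTop (𝓝 (f x)) := by
  set β := ((N : ℝ) + 1) * α with hβdef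
  have hβ : 0 < β := by positivity
  set W := iterModulus α a b x (N + 1) f (1 / (β + 1))
  have hW0 : 0 ≤ W := (modulusOn_nonneg _ _ _).trans (le_max_left _ _)
  have hΓ : 0 < Real.Gamma (β + 1) := Real.Gamma_pos_of_pos (by positivity)
  -- The step δ = 1/(β+1) of the modulus produces exactly the weight 1 + (β+1)|t-x| integrated
  -- earlier.
  have hmod : ∀ {g : ℝ → ℝ} {c d t : ℝ}, ContinuousOn g (Set.Icc c d) → x ∈ Set.Icc c d →
      t ∈ Set.Icc c d → modulusOn g (Set.Icc c d) (1 / (β + 1)) ≤ W →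
      |g t - g x| ≤ (1 + (β + 1) * |t - x|) * W := fun {g c d t} hg hxs ht hle => by
    refine (abs_sub_le_modulusOn isCompact_Icc (convex_Icc c d) hg
      (δ := 1 / (β + 1)) (by positivity) ht hxs).trans ?_
    rw [div_div_eq_mul_div, div_one, mul_comm |t - x|]
    exact mul_le_mul_of_nonneg_left hle (by positivity)
  have hpt : ∀ y ∈ Set.Icc a b,
      |f y - f x| ≤ W / Real.Gamma (β + 1) * (|y - x| ^ β + |y - x| ^ (β + 1)) := fun y hy => by
    rcases le_total x y with h | h
    · exact abs_sub_le_of_iterLeftCaputo_of_absolutelyContinuous hα0 hα1 hLac hLc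
        (fun t ht => hmod (hLc _ le_rfl) (Set.left_mem_Icc.2 hx.2) ht (le_max_left _ _)) ⟨h, hy.2⟩
    · exact abs_sub_le_of_iterRightCaputo_of_absolutelyContinuous hα0 hα1 hRac hRc
        (fun t ht => hmod (hRc _ le_rfl) (Set.right_mem_Icc.2 hx.1) ht (le_max_right _ _)) ⟨hy.1, h⟩
  have hba : 0 < b - a := sub_pos.2 hab
  have hbound : ∀ n : ℕ, 2 < (n : ℝ) ^ (1 - α) → ⌈(n : ℝ) * a⌉ ≤ ⌊(n : ℝ) * b⌋ →
      |nnOperator m a b n f x - f x| ≤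
        2 * (1 + (4 : ℝ) ^ m) ^ (1 / (2 * (m : ℝ))) * W / Real.Gamma (β + 1) *
        ((1 / (n : ℝ) ^ (((N : ℝ) + 1) * α ^ 2) +
            (b - a) ^ β / (4 * (m : ℝ) * ((n : ℝ) ^ (1 - α) - 2) ^ (2 * m))) +
          (1 / (n : ℝ) ^ (α * (β + 1)) +
            (b - a) ^ (β + 1) / (4 * (m : ℝ) * ((n : ℝ) ^ (1 - α) - 2) ^ (2 * m)))) := by
    intro n hM hk
    have hn : 0 < n := Nat.pos_of_ne_zero fun h => by
      rw [h, Nat.cast_zero, Real.zero_rpow (sub_pos.2 hα1).ne'] at hM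
      linarith
    have hn' : (0 : ℝ) < n := by exact_mod_cast hn
    -- The cutoff is M = n^(1-α), so near nodes satisfy |y-x| < n^(-α); P is the pointwise bound at
    -- that distance and Q the one at distance b - a.
    refine (abs_nnOperator_sub_le hm (f := f) hn hx hk hM
      (P := W / Real.Gamma (β + 1) * (1 / (n : ℝ) ^ (((N : ℝ) + 1) * α ^ 2) +
        1 / (n : ℝ) ^ (α * (β + 1))))
      (Q := W / Real.Gamma (β + 1) * ((b - a) ^ β + (b - a) ^ (β + 1)))
      (by positivity) (by positivity) ?_ ?_).trans_eq ?_
    · intro y hy hlt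
      have hle : |y - x| ≤ (n : ℝ) ^ (-α) := by
        rw [sub_eq_add_neg 1 α, Real.rpow_add hn', Real.rpow_one] at hlt
        exact (lt_of_mul_lt_mul_left hlt hn'.le).le
      have hpow : ∀ c : ℝ, 0 < c → |y - x| ^ c ≤ 1 / (n : ℝ) ^ (α * c) := fun c hc => by
        refine (Real.rpow_le_rpow (abs_nonneg _) hle hc.le).trans_eq ?_
        rw [← Real.rpow_mul hn'.le, neg_mul, Real.rpow_neg hn'.le, one_div]
      refine (hpt y hy).trans (mul_le_mul_of_nonneg_left (add_le_add ?_ ?_) (by positivity))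
      · rw [show ((N : ℝ) + 1) * α ^ 2 = α * β by rw [hβdef]; ring]
        exact hpow β hβ
      · exact hpow (β + 1) (by positivity)
    · intro y hy
      have hle : |y - x| ≤ b - a := abs_le.2
        ⟨by linarith [hy.1, hx.2], by linarith [hy.2, hx.1]⟩
      refine (hpt y hy).trans (mul_le_mul_of_nonneg_left ?_ (by positivity))
      gcongr
    · ring
  refine ⟨hbound, ?_⟩
  have hpow : ∀ c : ℝ, 0 < c → Tendsto (fun n : ℕ => (n : ℝ) ^ c) atTop atTop := fun c hc =>
    (tendsto_rpow_atTop hc).comp tendsto_natCast_atTop_atTop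
  have hinv : ∀ c : ℝ, 0 < c → Tendsto (fun n : ℕ => 1 / (n : ℝ) ^ c) atTop (𝓝 0) := fun c hc =>
    (hpow c hc).const_div_atTop 1
  have hm' : (0 : ℝ) < m := by exact_mod_cast hm
  have hM := hpow (1 - α) (sub_pos.2 hα1)
  have htail : ∀ c : ℝ, Tendsto (fun n : ℕ =>
      c / (4 * (m : ℝ) * ((n : ℝ) ^ (1 - α) - 2) ^ (2 * m))) atTop (𝓝 0) := fun c =>
    (((tendsto_pow_atTop (by omega)).comp (tendsto_atTop_add_const_right _ (-2) hM)).const_mul_atTop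
      (by positivity)).const_div_atTop c
  have hlim := ((((hinv (((N : ℝ) + 1) * α ^ 2) (by positivity)).add (htail ((b - a) ^ β))).add
    ((hinv (α * (β + 1)) (by positivity)).add (htail ((b - a) ^ (β + 1))))).const_mul
      (2 * (1 + (4 : ℝ) ^ m) ^ (1 / (2 * (m : ℝ))) * W / Real.Gamma (β + 1)))
  simp only [add_zero, mul_zero] at hlim
  rw [tendsto_iff_norm_sub_tendsto_zero]
  refine squeeze_zero' (Eventually.of_forall fun n => norm_nonneg _) ?_ hlim
  filter_upwards [hM.eventually_gt_atTop 2, eventually_ceil_le_floor hab] with n h1 h2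
  exact hbound n h1 h2
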